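/- For $\kappa\in\mathbb{R}$ let $M_\kappa^2$ be the complete, simply connected, two-dimensional Riemannian manifold of constant Gaussian curvature $\kappa$, with distance function $d_\kappa$, and let $D_\kappa$ be its diameter, so that $D_\kappa=\pi/\sqrt{\kappa}$ if $\kappa>0$ and $D_\kappa=\infty$ if $\kappa\le 0$. A line in $M_\kappa^2$ is the image of an isometric embedding of $\mathbb{R}$ if $\kappa\le 0$, and a great circle if $\kappa>0$. The sides of a line are the two connected components of its complement. For $0<d_\kappa(p,q)<D_\kappa$, $\ell(p,q)$ denotes the unique line through $p$ and $q$. If $0<d_\kappa(p,q)<D_\kappa$ and $0<d_\kappa(q,r)<D_\kappa$, then $\angle pqr\in[0,\pi]$ denotes the interior angle at $q$ of the (possibly degenerate) geodesic triangle with vertices $p,q,r$. **Lemma.** Let $\kappa\in\mathbb{R}$, and let $x,y,z,w,x',y',z',w'\in M_\kappa^2$ be points such that $$d_\kappa(x,y)+d_\kappa(y,z)+d_\kappa(z,w)+d_\kappa(w,x)<2D_\kappa,$$ $$d_\kappa(x,y)=d_\kappa(x',y'),\quad d_\kappa(y,z)=d_\kappa(y',z'),\quad d_\kappa(z,w)=d_\kappa(z',w'),$$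 $$d_\kappa(w,x)=d_\kappa(w',x'),\quad d_\kappa(y,w)\le d_\kappa(y',w').$$ Whenever $x\ne y$, $x\ne z$, $x\ne w$, $y\ne z$ and $z\ne w$ all hold, assume in addition that $\pi\le\angle yzx+\angle xzw$ and that $y$ and $w$ do not lie on the same side of $\ell(x,z)$. Then $$d_\kappa(x,z)\le d_\kappa(x',z').$$ -/

import Mathlib

open Set

noncomputable section

/-- The ambient space `ℝ × ℝ²` of the model planes, with coordinates `(t, v)`. -/
abbrev Ambient : Type := ℝ × EuclideanSpace ℝ (Fin 2)

/-- The model plane `M_κ²`: the complete, simply connected surface of constant curvature `κ`, as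
the surface `t² + κ |v|² = 1` (with `t > 0` when `κ ≤ 0`) in `ℝ × ℝ²`, with its subspace topology.
For `κ > 0`, `(t, v) ↦ (t / √κ, v)` carries it onto the round sphere of radius `1 / √κ` in `ℝ³`.
For `κ = 0` it is the Euclidean plane `t = 1`.
For `κ < 0` it is the upper sheet of the hyperboloid `t² - (√(-κ) |v|)² = 1`. -/
abbrev ModelPlane (κ : ℝ) : Type :=
  {p : Ambient // p.1 ^ 2 + κ * ‖p.2‖ ^ 2 = 1 ∧ (κ ≤ 0 → 0 < p.1)}

namespace ModelPlane

/-- The bilinear form `t t' + κ ⟨v, v'⟩` on `ℝ × ℝ²`. -/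
def form (κ : ℝ) (p q : Ambient) : ℝ := p.1 * q.1 + κ * inner ℝ p.2 q.2

/-- The distance function `d_κ` of the model plane. -/
def dist {κ : ℝ} (p q : ModelPlane κ) : ℝ :=
  if 0 < κ then Real.arccos (form κ p.1 q.1) / √κ
  else if κ = 0 then ‖p.1.2 - q.1.2‖
  else Real.arcosh (form κ p.1 q.1) / √(-κ)

/-- The diameter `D_κ` of the model plane. -/
def diam (κ : ℝ) : EReal := if 0 < κ then ((Real.pi / √κ : ℝ) : EReal) else ⊤

/-- The Riemannian metric of the model plane, on tangent vectors regarded as vectors of the ambient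
space: it is induced by `κ⁻¹ dt² + |dv|²` if `κ ≠ 0`, and is `|dv|²` if `κ = 0`. -/
def metric (κ : ℝ) (u w : Ambient) : ℝ :=
  if κ = 0 then inner ℝ u.2 w.2 else u.1 * w.1 / κ + inner ℝ u.2 w.2

/-- The component of `q` tangent to the model plane at `p`. For `0 < d_κ(p, q) < D_κ` it is a
positive multiple of the initial velocity at `p` of the geodesic segment from `p` to `q`. -/
def initialVector {κ : ℝ} (p q : ModelPlane κ) : Ambient := q.1 - form κ p.1 q.1 • p.1

/-- The interior angle `∠ x y z` at `y`, i.e. the Riemannian angle at `y` between the geodesic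
segments from `y` to `x` and from `y` to `z`. -/
def angle {κ : ℝ} (x y z : ModelPlane κ) : ℝ :=
  Real.arccos (metric κ (initialVector y x) (initialVector y z) /
    (√(metric κ (initialVector y x) (initialVector y x)) *
      √(metric κ (initialVector y z) (initialVector y z))))

/-- Lines: great circles (sections by two-dimensional linear subspaces) if `κ > 0`, images of
isometric embeddings of `ℝ` if `κ ≤ 0`. -/
def IsLine {κ : ℝ} (L : Set (ModelPlane κ)) : Prop :=
  if 0 < κ then
    ∃ W : Submodule ℝ Ambient, Module.finrank ℝ W = 2 ∧ L = {p | p.1 ∈ W}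
  else
    ∃ γ : ℝ → ModelPlane κ, (∀ s t : ℝ, dist (γ s) (γ t) = |s - t|) ∧ L = range γ

/-- The sides of `L` are the connected components of its complement. -/
def IsSide {κ : ℝ} (L S : Set (ModelPlane κ)) : Prop :=
  ∃ p ∈ Lᶜ, S = connectedComponentIn Lᶜ p

/-- `p` and `q` lie on the same side of `L`. -/
def SameSide {κ : ℝ} (L : Set (ModelPlane κ)) (p q : ModelPlane κ) : Prop :=
  ∃ S, IsSide L S ∧ p ∈ S ∧ q ∈ S

end ModelPlane

end

/-! All curvatures are treated at once by linear algebra in the ambient space. Since the angles at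
`z` add up to at least `π` and `y`, `w` are on opposite sides of the line (possibly on it), the
directions from `z` to `x`, `y`, `w` fit in no open half-plane. Hence `0` is a nontrivial
nonnegative combination of them, which means `a x + b y + c w = k z` with `a, b, c ≥ 0`
(`exists_relation`). Moreover `k > 0` (`coeff_pos`): for `κ > 0` this is where the perimeter bound
enters, through the fact that a short closed spherical quadrilateral lies in an open hemisphere.

Transport the coefficients to the primed points and let `e = k z' - a x' - b y' - c w'`. With `δ =
form x z - form x' z'` and `ε = form y' w' - form y w`, equality of the four sides gives `form e e =
2kaδ + 2bcε` and `form e x' = -kδ` (`form_defect`). If the conclusion failed, then: for `κ > 0`,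
`form e e ≤ 0` forces `e = 0`, so `δ = 0`; for `κ < 0`, `e` would be causal yet have products of
incompatible signs with `x'` and `z'`, two points of one sheet; for `κ = 0` the form degenerates,
and squared distances play its role. -/

noncomputable section

namespace ModelPlane

/-! ### Polynomial identities in the ambient space -/

/-- The determinant of three vectors of the ambient space. -/
def det (p q r : Ambient) : ℝ :=
  p.1 * (q.2 0 * r.2 1 - q.2 1 * r.2 0) - p.2 0 * (q.1 * r.2 1 - q.2 1 * r.1)
    + p.2 1 * (q.1 * r.2 0 - q.2 0 * r.1)

/-- The Riemannian inner product of the components of `p` and `q` tangent to the model plane at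
`z`, as a polynomial in the Plücker coordinates of `p ∧ z` and `q ∧ z`. -/
def tangentForm (κ : ℝ) (z p q : Ambient) : ℝ :=
  (p.1 * z.2 0 - p.2 0 * z.1) * (q.1 * z.2 0 - q.2 0 * z.1)
    + (p.1 * z.2 1 - p.2 1 * z.1) * (q.1 * z.2 1 - q.2 1 * z.1)
    + κ * ((p.2 0 * z.2 1 - p.2 1 * z.2 0) * (q.2 0 * z.2 1 - q.2 1 * z.2 0))

theorem inner_eq (u v : EuclideanSpace ℝ (Fin 2)) : inner ℝ u v = u 0 * v 0 + u 1 * v 1 := by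
  simp [PiLp.inner_apply, Fin.sum_univ_two, mul_comm]

theorem norm_sq_eq (u : EuclideanSpace ℝ (Fin 2)) : ‖u‖ ^ 2 = u 0 ^ 2 + u 1 ^ 2 := by
  rw [← real_inner_self_eq_norm_sq, inner_eq]; ring

theorem form_eq (κ : ℝ) (p q : Ambient) :
    form κ p q = p.1 * q.1 + κ * (p.2 0 * q.2 0 + p.2 1 * q.2 1) := by
  rw [form, inner_eq]

theorem form_comm (κ : ℝ) (p q : Ambient) : form κ p q = form κ q p := by
  simp only [form_eq]; ring

theorem form_add_left (κ : ℝ) (p q r : Ambient) :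
    form κ (p + q) r = form κ p r + form κ q r := by
  simp [form_eq]; ring

theorem form_sub_left (κ : ℝ) (p q r : Ambient) :
    form κ (p - q) r = form κ p r - form κ q r := by
  simp [form_eq]; ring

theorem form_smul_left (κ a : ℝ) (p r : Ambient) : form κ (a • p) r = a * form κ p r := by
  simp [form_eq]; ring

theorem form_zero_left (κ : ℝ) (r : Ambient) : form κ 0 r = 0 := by
  simp [form_eq]

theorem ambient_ext {p q : Ambient} (h : p.1 = q.1) (h0 : p.2 0 = q.2 0) (h1 : p.2 1 = q.2 1) :
    p = q := by
  refine Prod.ext h ?_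
  ext i
  fin_cases i
  · exact h0
  · exact h1

variable {κ : ℝ}

theorem coord_eq (p : ModelPlane κ) : p.1.1 ^ 2 + κ * (p.1.2 0 ^ 2 + p.1.2 1 ^ 2) = 1 := by
  rw [← norm_sq_eq]; exact p.2.1

theorem form_self (p : ModelPlane κ) : form κ p.1 p.1 = 1 := by
  rw [form_eq]; linear_combination coord_eq p

theorem fst_eq_one (p : ModelPlane 0) : p.1.1 = 1 := by
  have h := coord_eq p
  have h' := p.2.2 le_rfl
  nlinarith

/-- The factor `1 / κ` in the metric cancels because `form z z = 1`. What remains is polynomial in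
`κ`, so the angle computations need no case distinction. -/
theorem metric_initialVector (z p q : ModelPlane κ) :
    metric κ (initialVector z p) (initialVector z q) = tangentForm κ z.1 p.1 q.1 := by
  have hz := coord_eq z
  unfold metric tangentForm
  split_ifs with h
  · subst h
    simp [inner_eq, initialVector, form_eq, fst_eq_one]
    ring
  · simp only [inner_eq, initialVector, form_eq, Prod.fst_sub, Prod.snd_sub, Prod.smul_fst,
      Prod.smul_snd, PiLp.sub_apply, PiLp.smul_apply, smul_eq_mul]
    rw [div_add' _ _ _ h, div_eq_iff h]
    linear_combination ((p.1.1 * z.1.1 + κ * (p.1.2 0 * z.1.2 0 + p.1.2 1 * z.1.2 1))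
        * (q.1.1 * z.1.1 + κ * (q.1.2 0 * z.1.2 0 + q.1.2 1 * z.1.2 1))
      - (p.1.1 * q.1.1 + κ * (p.1.2 0 * q.1.2 0 + p.1.2 1 * q.1.2 1))) * hz

theorem mul_tangentForm (z p q : ModelPlane κ) :
    κ * tangentForm κ z.1 p.1 q.1 = form κ p.1 q.1 - form κ p.1 z.1 * form κ q.1 z.1 := by
  have hz := coord_eq z
  simp only [form_eq, tangentForm]
  linear_combination (p.1.1 * q.1.1 + κ * (p.1.2 0 * q.1.2 0 + p.1.2 1 * q.1.2 1)) * hz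

/-- Lagrange's identity in the tangent plane at `z`: `tangentForm` carries the cosine of the angle
at `z`, and `det` the signed sine. -/
theorem tangentForm_mul_self (z p q : ModelPlane κ) :
    tangentForm κ z.1 p.1 p.1 * tangentForm κ z.1 q.1 q.1
      = tangentForm κ z.1 p.1 q.1 ^ 2 + det p.1 z.1 q.1 ^ 2 := by
  have h : tangentForm κ z.1 p.1 p.1 * tangentForm κ z.1 q.1 q.1
      = tangentForm κ z.1 p.1 q.1 ^ 2 + det p.1 z.1 q.1 ^ 2 * form κ z.1 z.1 := by
    simp only [det, tangentForm, form_eq]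
    ring
  rw [h, form_self, mul_one]

/-- The sine subtraction formula at `z`, measured from the direction of `x`. It determines the sign
of the coefficient of `x` in `cramer`. -/
theorem tangentForm_mul_det (x y z w : ModelPlane κ) :
    tangentForm κ z.1 x.1 x.1 * det y.1 z.1 w.1
      = tangentForm κ z.1 y.1 x.1 * det x.1 z.1 w.1
        - tangentForm κ z.1 x.1 w.1 * det x.1 z.1 y.1 := by
  simp only [det, tangentForm]
  ring

theorem cramer (x y z w : Ambient) :
    det y z w • x + (-det x z w) • y + det x z y • w = (-det x y w) • z := by
  apply ambient_ext <;> simp [det] <;> ring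

/-- Removing from `y` its components along `z` and along the tangential part of `x` leaves a
multiple of the normal to the plane of `x` and `z`, with factor `det x z y`. This replaces `cramer`
when all its relevant determinants vanish. -/
theorem tangentForm_smul (x y z : ModelPlane κ) (h : det x.1 z.1 y.1 = 0) :
    tangentForm κ z.1 x.1 x.1 • y.1 - tangentForm κ z.1 y.1 x.1 • x.1
      = (tangentForm κ z.1 x.1 x.1 * form κ y.1 z.1
          - tangentForm κ z.1 y.1 x.1 * form κ x.1 z.1) • z.1 := by
  have h' : (form κ z.1 z.1 * tangentForm κ z.1 x.1 x.1) • y.1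
      - (form κ z.1 z.1 * tangentForm κ z.1 y.1 x.1) • x.1
      - (tangentForm κ z.1 x.1 x.1 * form κ y.1 z.1
          - tangentForm κ z.1 y.1 x.1 * form κ x.1 z.1) • z.1
      = (det x.1 z.1 y.1 * form κ z.1 z.1) • (κ * (x.1.2 0 * z.1.2 1 - x.1.2 1 * z.1.2 0),
        !₂[x.1.2 1 * z.1.1 - x.1.1 * z.1.2 1, x.1.1 * z.1.2 0 - x.1.2 0 * z.1.1]) := by
    apply ambient_ext <;> simp [det, tangentForm, form_eq] <;> ring
  rwa [form_self, h, one_mul, one_mul, mul_one, zero_smul, sub_eq_zero] at h'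

/-! ### The distance function and the bilinear form -/

theorem abs_form_le_one (hκ : 0 < κ) (p q : ModelPlane κ) : |form κ p.1 q.1| ≤ 1 := by
  have hp := coord_eq p
  have hq := coord_eq q
  rw [form_eq, abs_le]
  constructor
  · nlinarith [sq_nonneg (p.1.1 + q.1.1), mul_nonneg hκ.le (sq_nonneg (p.1.2 0 + q.1.2 0)),
      mul_nonneg hκ.le (sq_nonneg (p.1.2 1 + q.1.2 1))]
  · nlinarith [sq_nonneg (p.1.1 - q.1.1), mul_nonneg hκ.le (sq_nonneg (p.1.2 0 - q.1.2 0)),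
      mul_nonneg hκ.le (sq_nonneg (p.1.2 1 - q.1.2 1))]

/-- Reversed Cauchy–Schwarz: a Lagrange identity compares squares, and positivity of the time
coordinates selects the root. -/
theorem one_le_form (hκ : κ < 0) (p q : ModelPlane κ) : 1 ≤ form κ p.1 q.1 := by
  have hp := coord_eq p
  have hq := coord_eq q
  have hp' := p.2.2 hκ.le
  have hq' := q.2.2 hκ.le
  set P := 1 - κ * (p.1.2 0 * q.1.2 0 + p.1.2 1 * q.1.2 1) with hP
  have h : P ^ 2 ≤ (p.1.1 * q.1.1) ^ 2 := by
    have : (p.1.1 * q.1.1) ^ 2 - P ^ 2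
        = (-κ) * ((p.1.2 0 - q.1.2 0) ^ 2 + (p.1.2 1 - q.1.2 1) ^ 2)
          + (κ * (p.1.2 0 * q.1.2 1 - p.1.2 1 * q.1.2 0)) ^ 2 := by
      rw [hP]
      linear_combination q.1.1 ^ 2 * hp + (1 - κ * (p.1.2 0 ^ 2 + p.1.2 1 ^ 2)) * hq
    have h1 : 0 ≤ (-κ) * ((p.1.2 0 - q.1.2 0) ^ 2 + (p.1.2 1 - q.1.2 1) ^ 2) :=
      mul_nonneg (by linarith) (by positivity)
    nlinarith [sq_nonneg (κ * (p.1.2 0 * q.1.2 1 - p.1.2 1 * q.1.2 0))]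
  have := abs_le_of_sq_le_sq' h (mul_pos hp' hq').le
  rw [form_eq]
  linarith [this.2]

theorem eq_of_form_eq_one (hκ : κ ≠ 0) {p q : ModelPlane κ} (h : form κ p.1 q.1 = 1) :
    p = q := by
  have hp := coord_eq p
  have hq := coord_eq q
  rw [form_eq] at h
  rcases lt_or_gt_of_ne hκ with hκ | hκ
  · have hp' := p.2.2 hκ.le
    have hq' := q.2.2 hκ.le
    have h2 : (-κ) * ((p.1.2 0 - q.1.2 0) ^ 2 + (p.1.2 1 - q.1.2 1) ^ 2)
          + (κ * (p.1.2 0 * q.1.2 1 - p.1.2 1 * q.1.2 0)) ^ 2 = 0 := by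
      linear_combination -q.1.1 ^ 2 * hp - (1 - κ * (p.1.2 0 ^ 2 + p.1.2 1 ^ 2)) * hq
        + (p.1.1 * q.1.1 + 1 - κ * (p.1.2 0 * q.1.2 0 + p.1.2 1 * q.1.2 1)) * h
    have h3 : (-κ) * ((p.1.2 0 - q.1.2 0) ^ 2 + (p.1.2 1 - q.1.2 1) ^ 2) ≤ 0 := by
      nlinarith [sq_nonneg (κ * (p.1.2 0 * q.1.2 1 - p.1.2 1 * q.1.2 0))]
    have h4 := nonpos_of_mul_nonpos_right h3 (neg_pos.2 hκ)
    have h5 : p.1.2 0 = q.1.2 0 := by nlinarith [sq_nonneg (p.1.2 1 - q.1.2 1)]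
    have h6 : p.1.2 1 = q.1.2 1 := by nlinarith [sq_nonneg (p.1.2 0 - q.1.2 0)]
    refine Subtype.ext (ambient_ext ?_ h5 h6)
    rw [h5, h6] at hp
    exact (sq_eq_sq₀ hp'.le hq'.le).1 (by linarith)
  · have h2 : (p.1.1 - q.1.1) ^ 2 + κ * ((p.1.2 0 - q.1.2 0) ^ 2 + (p.1.2 1 - q.1.2 1) ^ 2) = 0 := by
      linear_combination hp + hq - 2 * h
    have h3 : 0 ≤ κ * ((p.1.2 0 - q.1.2 0) ^ 2 + (p.1.2 1 - q.1.2 1) ^ 2) := by positivity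
    have h4 : (p.1.2 0 - q.1.2 0) ^ 2 + (p.1.2 1 - q.1.2 1) ^ 2 ≤ 0 :=
      nonpos_of_mul_nonpos_right (by nlinarith [sq_nonneg (p.1.1 - q.1.1)]) hκ
    exact Subtype.ext (ambient_ext (by nlinarith)
      (by nlinarith [sq_nonneg (p.1.2 1 - q.1.2 1)])
      (by nlinarith [sq_nonneg (p.1.2 0 - q.1.2 0)]))

theorem dist_of_pos (hκ : 0 < κ) (p q : ModelPlane κ) :
    dist p q = Real.arccos (form κ p.1 q.1) / √κ := if_pos hκ

theorem dist_of_neg (hκ : κ < 0) (p q : ModelPlane κ) :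
    dist p q = Real.arcosh (form κ p.1 q.1) / √(-κ) := by
  rw [dist, if_neg hκ.not_gt, if_neg hκ.ne]

theorem dist_of_zero (p q : ModelPlane 0) : dist p q = ‖p.1.2 - q.1.2‖ := by
  simp [dist]

theorem dist_le_dist_of_pos (hκ : 0 < κ) (p q p' q' : ModelPlane κ) :
    dist p q ≤ dist p' q' ↔ form κ p'.1 q'.1 ≤ form κ p.1 q.1 := by
  rw [dist_of_pos hκ, dist_of_pos hκ, div_le_div_iff_of_pos_right (Real.sqrt_pos.2 hκ)]
  exact Real.strictAntiOn_arccos.le_iff_ge (abs_le.1 (abs_form_le_one hκ p q))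
    (abs_le.1 (abs_form_le_one hκ p' q'))

theorem dist_le_dist_of_neg (hκ : κ < 0) (p q p' q' : ModelPlane κ) :
    dist p q ≤ dist p' q' ↔ form κ p.1 q.1 ≤ form κ p'.1 q'.1 := by
  rw [dist_of_neg hκ, dist_of_neg hκ,
    div_le_div_iff_of_pos_right (Real.sqrt_pos.2 (neg_pos.2 hκ))]
  exact Real.arcosh_le_arcosh (by linarith [one_le_form hκ p q])
    (by linarith [one_le_form hκ p' q'])

theorem dist_comm (p q : ModelPlane κ) : dist p q = dist q p := by
  simp only [dist, form_comm κ p.1 q.1, norm_sub_rev p.1.2 q.1.2]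

theorem dist_nonneg (p q : ModelPlane κ) : 0 ≤ dist p q := by
  unfold dist
  split_ifs with h1 h2
  · exact div_nonneg (Real.arccos_nonneg _) (Real.sqrt_nonneg _)
  · exact norm_nonneg _
  · exact div_nonneg (Real.arcosh_nonneg (one_le_form (by grind) p q)) (Real.sqrt_nonneg _)

theorem dist_self (p : ModelPlane κ) : dist p p = 0 := by
  simp [dist, form_self]

theorem eq_of_dist_eq_zero {p q : ModelPlane κ} (h : dist p q = 0) : p = q := by
  rcases lt_trichotomy κ 0 with hκ | rfl | hκ
  · apply eq_of_form_eq_one hκ.ne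
    rw [← dist_self p] at h
    have := (dist_le_dist_of_neg hκ _ _ _ _).1 h.le
    rw [form_self] at this
    exact this.antisymm (one_le_form hκ p q)
  · rw [dist_of_zero, norm_eq_zero, sub_eq_zero] at h
    exact Subtype.ext (Prod.ext (by rw [fst_eq_one, fst_eq_one]) h)
  · apply eq_of_form_eq_one hκ.ne'
    rw [← dist_self p] at h
    have := (dist_le_dist_of_pos hκ _ _ _ _).1 h.le
    rw [form_self] at this
    exact ((abs_le.1 (abs_form_le_one hκ p q)).2).antisymm this

theorem form_eq_of_neg (hκ : κ < 0) (p q : ModelPlane κ) :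
    form κ p.1 q.1 = Real.cosh (√(-κ) * dist p q) := by
  have : √(-κ) ≠ 0 := (Real.sqrt_pos.2 (neg_pos.2 hκ)).ne'
  rw [dist_of_neg hκ, mul_div_cancel₀ _ this, Real.cosh_arcosh (one_le_form hκ p q)]

theorem dist_sq_of_zero (p q : ModelPlane 0) :
    dist p q ^ 2 = (p.1.2 0 - q.1.2 0) ^ 2 + (p.1.2 1 - q.1.2 1) ^ 2 := by
  rw [dist_of_zero, norm_sq_eq]; rfl

/-- The squared length of the tangential component is positive away from the base point and its
antipode. -/
theorem tangentForm_self_pos {p z : ModelPlane κ} (h : p ≠ z)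
    (h' : 0 < κ → form κ p.1 z.1 ≠ -1) : 0 < tangentForm κ z.1 p.1 p.1 := by
  have hm := mul_tangentForm z p p
  rw [form_self] at hm
  rcases lt_trichotomy κ 0 with hκ | rfl | hκ
  · have h1 := (one_le_form hκ p z).lt_of_ne' fun h1 => h (eq_of_form_eq_one hκ.ne h1)
    nlinarith
  · have h1 : dist p z ≠ 0 := fun h1 => h (eq_of_dist_eq_zero h1)
    have h2 := dist_sq_of_zero p z
    simp only [tangentForm, fst_eq_one]
    have := pow_pos ((dist_nonneg p z).lt_of_ne' h1) 2
    linarith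
  · obtain ⟨h1, h2⟩ := abs_le.1 (abs_form_le_one hκ p z)
    have h1 := h1.lt_of_ne' (h' hκ)
    have h2 := h2.lt_of_ne fun h1 => h (eq_of_form_eq_one hκ.ne' h1)
    have h3 : 0 < κ * tangentForm κ z.1 p.1 p.1 := by nlinarith
    exact pos_of_mul_pos_right h3 hκ.le

/-! ### Lines and their sides -/

theorem det_eq_zero_of_finrank_eq_two {W : Submodule ℝ Ambient} (hW : Module.finrank ℝ W = 2)
    {p q r : Ambient} (hp : p ∈ W) (hq : q ∈ W) (hr : r ∈ W) : det p q r = 0 := by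
  by_contra hdet
  have hli : LinearIndependent ℝ (![⟨p, hp⟩, ⟨q, hq⟩, ⟨r, hr⟩] : Fin 3 → W) := by
    rw [Fintype.linearIndependent_iff]
    intro g hg
    have hg' : g 0 • p + g 1 • q + g 2 • r = 0 := by
      simpa [Fin.sum_univ_three] using congrArg Subtype.val hg
    have e0 := congrArg (fun v : Ambient => v.1) hg'
    have e1 := congrArg (fun v : Ambient => v.2 0) hg'
    have e2 := congrArg (fun v : Ambient => v.2 1) hg'
    simp only [Prod.fst_add, Prod.smul_fst, smul_eq_mul, Prod.fst_zero, Prod.snd_add,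
      Prod.smul_snd, PiLp.add_apply, PiLp.smul_apply, Prod.snd_zero, PiLp.zero_apply] at e0 e1 e2
    have h0 : det p q r * g 0 = 0 := by
      simp only [det]
      linear_combination (q.2 0 * r.2 1 - q.2 1 * r.2 0) * e0
        - (q.1 * r.2 1 - q.2 1 * r.1) * e1 + (q.1 * r.2 0 - q.2 0 * r.1) * e2
    have h1 : det p q r * g 1 = 0 := by
      simp only [det]
      linear_combination (r.2 0 * p.2 1 - r.2 1 * p.2 0) * e0
        - (r.1 * p.2 1 - r.2 1 * p.1) * e1 + (r.1 * p.2 0 - r.2 0 * p.1) * e2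
    have h2 : det p q r * g 2 = 0 := by
      simp only [det]
      linear_combination (p.2 0 * q.2 1 - p.2 1 * q.2 0) * e0
        - (p.1 * q.2 1 - p.2 1 * q.1) * e1 + (p.1 * q.2 0 - p.2 0 * q.1) * e2
    intro i
    fin_cases i
    · exact (mul_eq_zero.1 h0).resolve_left hdet
    · exact (mul_eq_zero.1 h1).resolve_left hdet
    · exact (mul_eq_zero.1 h2).resolve_left hdet
  have : Module.Finite ℝ W := Module.finite_of_finrank_pos (by omega)
  have := hli.fintype_card_le_finrank
  simp [hW] at this

/-- The form has determinant `κ ^ 2`, so the Gram determinant is `κ ^ 2` times the squared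
determinant of the vectors. -/
theorem gram_det (κ : ℝ) (p q r : Ambient) :
    form κ p p * form κ q q * form κ r r
      + 2 * form κ p q * form κ q r * form κ p r
      - form κ p p * form κ q r ^ 2 - form κ q q * form κ p r ^ 2 - form κ r r * form κ p q ^ 2
      = (κ * det p q r) ^ 2 := by
  simp only [form_eq, det]
  ring

theorem IsLine.det_eq_zero {L : Set (ModelPlane κ)} (hL : IsLine L) {p q r : ModelPlane κ}
    (hp : p ∈ L) (hq : q ∈ L) (hr : r ∈ L) : det p.1 q.1 r.1 = 0 := by
  unfold IsLine at hL
  split_ifs at hL with hκ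
  · obtain ⟨W, hW, rfl⟩ := hL
    exact det_eq_zero_of_finrank_eq_two hW hp hq hr
  · obtain ⟨γ, hγ, rfl⟩ := hL
    obtain ⟨a, rfl⟩ := hp
    obtain ⟨b, rfl⟩ := hq
    obtain ⟨c, rfl⟩ := hr
    rcases (not_lt.1 hκ).lt_or_eq with hκ | rfl
    -- The addition formula for `cosh` shows that the Gram matrix along a geodesic has rank at most
    -- two, so its determinant vanishes.
    · have hF : ∀ s t, form κ (γ s).1 (γ t).1
          = Real.cosh (√(-κ) * s) * Real.cosh (√(-κ) * t)
            - Real.sinh (√(-κ) * s) * Real.sinh (√(-κ) * t) := by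
        intro s t
        rw [form_eq_of_neg hκ, hγ, ← Real.cosh_sub, ← mul_sub, ← Real.cosh_abs, abs_mul,
          abs_abs, ← abs_mul, Real.cosh_abs]
      have h := gram_det κ (γ a).1 (γ b).1 (γ c).1
      simp only [hF] at h
      have h' : (κ * det (γ a).1 (γ b).1 (γ c).1) ^ 2 = 0 := by
        rw [← h]; ring
      exact (mul_eq_zero.1 (pow_eq_zero_iff two_ne_zero |>.1 h')).resolve_left hκ.ne
    · have hab := dist_sq_of_zero (γ a) (γ b)
      have hbc := dist_sq_of_zero (γ b) (γ c)
      have hac := dist_sq_of_zero (γ a) (γ c)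
      rw [hγ, sq_abs] at hab hbc hac
      -- Heron's formula: here `det` is twice the signed area of the triangle.
      have h' : 4 * det (γ a).1 (γ b).1 (γ c).1 ^ 2
          = 4 * (a - b) ^ 2 * (a - c) ^ 2 - ((a - b) ^ 2 + (a - c) ^ 2 - (b - c) ^ 2) ^ 2 := by
        rw [hab, hbc, hac]
        simp only [det, fst_eq_one]
        ring
      have h0 : det (γ a).1 (γ b).1 (γ c).1 ^ 2 = 0 := by nlinarith
      exact pow_eq_zero_iff two_ne_zero |>.1 h0

theorem det_comb_right (p q y w : Ambient) (a b : ℝ) :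
    det p q (a • y + b • w) = a * det p q y + b * det p q w := by
  simp [det]; ring

theorem form_self_pos_of_pos (hκ : 0 < κ) {p : Ambient} (hp : p ≠ 0) : 0 < form κ p p := by
  have h : form κ p p = p.1 ^ 2 + κ * (p.2 0 ^ 2 + p.2 1 ^ 2) := by rw [form_eq]; ring
  have h1 : 0 ≤ κ * (p.2 0 ^ 2 + p.2 1 ^ 2) := by positivity
  rw [h]
  refine lt_of_le_of_ne (by positivity) fun h0 => hp ?_
  have h2 : p.2 0 ^ 2 + p.2 1 ^ 2 ≤ 0 :=
    nonpos_of_mul_nonpos_right (by nlinarith [sq_nonneg p.1]) hκ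
  apply ambient_ext <;> simp <;> nlinarith [sq_nonneg (p.2 0), sq_nonneg (p.2 1)]

theorem form_pos_of_nonpos (hκ : κ ≤ 0) (p q : ModelPlane κ) : 0 < form κ p.1 q.1 := by
  rcases hκ.lt_or_eq with hκ | rfl
  · linarith [one_le_form hκ p q]
  · simp [form_eq, fst_eq_one]

/-- The radial projection to the model plane. -/
def project (κ : ℝ) (p : Ambient) (h : 0 < form κ p p) (h' : κ ≤ 0 → 0 < p.1) : ModelPlane κ :=
  ⟨(√(form κ p p))⁻¹ • p, by
    have h2 : (√(form κ p p))⁻¹ ^ 2 * form κ p p = 1 := by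
      rw [inv_pow, Real.sq_sqrt h.le, inv_mul_cancel₀ h.ne']
    refine ⟨?_, fun hκ => ?_⟩
    · simp only [norm_sq_eq, Prod.smul_fst, Prod.smul_snd, PiLp.smul_apply, smul_eq_mul]
      linear_combination h2 - (√(form κ p p))⁻¹ ^ 2 * form_eq κ p p
    · exact mul_pos (inv_pos.2 (Real.sqrt_pos.2 h)) (h' hκ)⟩

/-- The ambient segment from `y` to `w` never meets the plane `det x z · = 0`, because `det` is
affine along it with endpoint values of one sign. Its radial projection is then a path avoiding `L`.
-/
theorem sameSide_of_det_pos {L : Set (ModelPlane κ)} {x z y w : ModelPlane κ}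
    (hL : ∀ p ∈ L, det x.1 z.1 p.1 = 0) (h : 0 < det x.1 z.1 y.1 * det x.1 z.1 w.1) :
    SameSide L y w := by
  let g : unitInterval → Ambient := fun t => (1 - t : ℝ) • y.1 + (t : ℝ) • w.1
  have hdet : ∀ t, det x.1 z.1 (g t) ≠ 0 := by
    intro t h0
    rw [det_comb_right] at h0
    have h1 := t.2.1
    have h2 := t.2.2
    set A := det x.1 z.1 y.1
    set B := det x.1 z.1 w.1
    have hA : A ≠ 0 := left_ne_zero_of_mul h.ne'
    have h3 : (1 - t : ℝ) * A ^ 2 + t * (A * B) = 0 := by linear_combination A * h0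
    rcases h1.lt_or_eq with h1 | h1
    · nlinarith [mul_pos h1 h, mul_nonneg (sub_nonneg.2 h2) (sq_nonneg A)]
    · rw [← h1] at h3
      simp [hA] at h3
  have hform : ∀ t, 0 < form κ (g t) (g t) := by
    intro t
    rcases lt_or_ge 0 κ with hκ | hκ
    · refine form_self_pos_of_pos hκ fun h0 => hdet t ?_
      simp [h0, det]
    · have hF := form_pos_of_nonpos hκ y w
      have h3 : form κ (g t) (g t)
          = (1 - t) ^ 2 + t ^ 2 + 2 * (t * (1 - t)) * form κ y.1 w.1 := by
        have hr : ∀ u, form κ (g t) u = (1 - t) * form κ y.1 u + t * form κ w.1 u := fun u => by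
          rw [form_add_left, form_smul_left, form_smul_left]
        rw [hr, form_comm κ y.1, form_comm κ w.1, hr, hr, form_self, form_self,
          form_comm κ w.1 y.1]
        ring
      have h4 : 0 ≤ (t : ℝ) * (1 - t) := mul_nonneg t.2.1 (sub_nonneg.2 t.2.2)
      rw [h3]
      nlinarith [mul_nonneg h4 hF.le, sq_nonneg (1 - 2 * (t : ℝ))]
  have hfst : ∀ t, κ ≤ 0 → 0 < (g t).1 := by
    intro t hκ
    have h1 := y.2.2 hκ
    have h2 := w.2.2 hκ
    have h3 := t.2.1
    have h4 := t.2.2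
    simp only [g, Prod.fst_add, Prod.smul_fst, smul_eq_mul]
    rcases h3.lt_or_eq with h3 | h3
    · nlinarith [mul_pos h3 h2, mul_nonneg (sub_nonneg.2 h4) h1.le]
    · rw [← h3]; simpa using h1
  let f : unitInterval → ModelPlane κ := fun t => project κ (g t) (hform t) (hfst t)
  have hg : Continuous g := by fun_prop
  have hf : Continuous f := by
    refine Continuous.subtype_mk ?_ _
    have hF : Continuous fun t => form κ (g t) (g t) := by
      unfold form
      fun_prop
    exact ((hF.sqrt).inv₀ fun t => (Real.sqrt_pos.2 (hform t)).ne').smul hg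
  have hfL : range f ⊆ Lᶜ := by
    rintro _ ⟨t, rfl⟩ ht
    have h1 := hL _ ht
    have h2 : det x.1 z.1 (f t).1 = (√(form κ (g t) (g t)))⁻¹ * det x.1 z.1 (g t) := by
      simp only [f, project]
      have := det_comb_right x.1 z.1 (g t) 0 (√(form κ (g t) (g t)))⁻¹ 0
      simpa using this
    rw [h2] at h1
    exact hdet t ((mul_eq_zero.1 h1).resolve_left
      (inv_ne_zero (Real.sqrt_pos.2 (hform t)).ne'))
  have hy : f 0 = y := Subtype.ext (by simp [f, project, g, form_self])
  have hw : f 1 = w := Subtype.ext (by simp [f, project, g, form_self])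
  have hyr : y ∈ range f := ⟨0, hy⟩
  have hsub := (isPreconnected_range hf).subset_connectedComponentIn hyr hfL
  exact ⟨_, ⟨y, hfL hyr, rfl⟩, hsub hyr, hsub ⟨1, hw⟩⟩

theorem IsLine.det_mul_det_nonpos {L : Set (ModelPlane κ)} (hL : IsLine L)
    {x z y w : ModelPlane κ} (hx : x ∈ L) (hz : z ∈ L) (h : ¬ SameSide L y w) :
    det x.1 z.1 y.1 * det x.1 z.1 w.1 ≤ 0 :=
  not_lt.1 fun h' => h (sameSide_of_det_pos (fun _ hp => hL.det_eq_zero hx hz hp) h')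

/-! ### The linear relation given by a reflex angle -/

/-- If two angles in `[0, π]` with cosines `P / √(P² + c²)` and `R / √(R² + b²)` add up to at
least `π`, then the sum of their cotangents `P / c` and `R / b` is nonpositive. -/
theorem mul_add_mul_nonpos {P R V Q b c : ℝ} (hb : 0 ≤ b) (hc : 0 ≤ c)
    (hV : V ^ 2 = P ^ 2 + c ^ 2) (hQ : Q ^ 2 = R ^ 2 + b ^ 2) (hV0 : 0 < V) (hQ0 : 0 < Q)
    (h : P * Q + R * V ≤ 0) : P * b + R * c ≤ 0 := by
  rcases le_or_gt P 0 with hP | hP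
  · rcases le_or_gt R 0 with hR | hR
    · nlinarith
    · have h1 : (R * V) ^ 2 ≤ (-P * Q) ^ 2 := pow_le_pow_left₀ (by positivity) (by linarith) 2
      have h2 : (R * c) ^ 2 ≤ (-P * b) ^ 2 := by
        rw [mul_pow, hV, mul_pow, hQ] at h1
        linarith
      have := abs_le_of_sq_le_sq' h2 (mul_nonneg (by linarith) hb)
      linarith [this.2]
  · have hR : R < 0 := by
      by_contra hR
      nlinarith [mul_pos hP hQ0, mul_nonneg (not_lt.1 hR) hV0.le]
    have h1 : (P * Q) ^ 2 ≤ (-R * V) ^ 2 := pow_le_pow_left₀ (by positivity) (by linarith) 2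
    have h2 : (P * b) ^ 2 ≤ (-R * c) ^ 2 := by
      rw [mul_pow, hQ, mul_pow, hV] at h1
      linarith
    have := abs_le_of_sq_le_sq' h2 (mul_nonneg (by linarith) hc)
    linarith [this.2]

/-- If one angle is `0` or `π`, the other is strictly between, and the sum is at least `π`, then the
first one is `π`. -/
theorem neg_of_mul_add_mul_nonpos {P R V Q b : ℝ} (hV : V ^ 2 = P ^ 2)
    (hQ : Q ^ 2 = R ^ 2 + b ^ 2) (hV0 : 0 < V) (hQ0 : 0 < Q) (hb : b ≠ 0)
    (h : P * Q + R * V ≤ 0) : P < 0 := by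
  by_contra hP
  have hPV : V = P := (sq_eq_sq₀ hV0.le (not_lt.1 hP)).1 hV
  subst hPV
  have h1 : Q ≤ -R := by nlinarith
  have h2 : Q ^ 2 ≤ (-R) ^ 2 := pow_le_pow_left₀ hQ0.le h1 2
  have := pow_pos (abs_pos.2 hb) 2
  rw [sq_abs] at this
  nlinarith

theorem exists_relation_of_nonneg {x y z w : ModelPlane κ} {V Q b c : ℝ} {P R A : ℝ}
    (hP : P = tangentForm κ z.1 y.1 x.1) (hR : R = tangentForm κ z.1 x.1 w.1)
    (hA : A = tangentForm κ z.1 x.1 x.1) (hA0 : 0 < A)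
    (hV : V ^ 2 = P ^ 2 + c ^ 2) (hQ : Q ^ 2 = R ^ 2 + b ^ 2) (hV0 : 0 < V) (hQ0 : 0 < Q)
    (h : P * Q + R * V ≤ 0) (hb : 0 ≤ b) (hc : 0 ≤ c)
    (hbc : b = -det x.1 z.1 w.1 ∧ c = det x.1 z.1 y.1 ∨
      b = det x.1 z.1 w.1 ∧ c = -det x.1 z.1 y.1) :
    ∃ a b c k : ℝ, 0 ≤ a ∧ 0 ≤ b ∧ 0 ≤ c ∧ (0 < a ∨ 0 < b ∧ 0 < c) ∧
      a • x.1 + b • y.1 + c • w.1 = k • z.1 := by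
  have hle := mul_add_mul_nonpos hb hc hV hQ hV0 hQ0 h
  by_cases hb0 : b = 0 ∧ c = 0
  · obtain ⟨rfl, rfl⟩ := hb0
    have hy : det x.1 z.1 y.1 = 0 := by grind
    have hw : det x.1 z.1 w.1 = 0 := by grind
    by_cases hP0 : P < 0
    · refine ⟨-P, A, 0, A * form κ y.1 z.1 - P * form κ x.1 z.1, by linarith, hA0.le, le_rfl,
        Or.inl (by linarith), ?_⟩
      rw [hA, hP, ← tangentForm_smul x y z hy]
      module
    · have hR0 : R < 0 := by
        by_contra hR0
        have : P ≠ 0 := by rintro rfl; norm_num at hV; linarith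
        have hP0 : 0 < P := lt_of_le_of_ne (not_lt.1 hP0) this.symm
        nlinarith [mul_pos hP0 hQ0, mul_nonneg (not_lt.1 hR0) hV0.le]
      refine ⟨-R, 0, A, A * form κ w.1 z.1 - R * form κ x.1 z.1, by linarith, le_rfl, hA0.le,
        Or.inl (by linarith), ?_⟩
      have hcomm : tangentForm κ z.1 x.1 w.1 = tangentForm κ z.1 w.1 x.1 := by
        simp only [tangentForm]; ring
      rw [hA, hR, hcomm, ← tangentForm_smul x w z hw]
      module
  -- Cramer's relation, up to a global sign making `b` and `c` nonnegative; the cotangent inequality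
  -- `hle` then gives `0 ≤ a`.
  · obtain ⟨a, k, ha, hrel⟩ : ∃ a k : ℝ, A * a = -(P * b + R * c) ∧
        a • x.1 + b • y.1 + c • w.1 = k • z.1 := by
      have hdet := tangentForm_mul_det x y z w
      have hcr := cramer x.1 y.1 z.1 w.1
      rcases hbc with ⟨hb', hc'⟩ | ⟨hb', hc'⟩
      · refine ⟨det y.1 z.1 w.1, -det x.1 y.1 w.1, ?_, ?_⟩
        · rw [hA, hb', hc', hP, hR]; linear_combination hdet
        · rw [hb', hc', hcr]
      · refine ⟨-det y.1 z.1 w.1, det x.1 y.1 w.1, ?_, ?_⟩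
        · rw [hA, hb', hc', hP, hR]; linear_combination -hdet
        · have hneg := congrArg Neg.neg hcr
          rw [neg_smul _ z.1, neg_neg] at hneg
          rw [hb', hc', ← hneg]
          module
    have ha0 : 0 ≤ a := nonneg_of_mul_nonneg_right (by linarith) hA0
    refine ⟨a, b, c, k, ha0, hb, hc, ?_, hrel⟩
    rcases hb.lt_or_eq with hb' | hb' <;> rcases hc.lt_or_eq with hc' | hc'
    · exact Or.inr ⟨hb', hc'⟩
    · subst hc'
      have hP0 : P < 0 := neg_of_mul_add_mul_nonpos (by linarith) hQ hV0 hQ0 hb'.ne' h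
      exact Or.inl (pos_of_mul_pos_right (by nlinarith : 0 < A * a) hA0.le)
    · subst hb'
      have hR0 : R < 0 :=
        neg_of_mul_add_mul_nonpos (by linarith) hV hQ0 hV0 hc'.ne' (by linarith)
      exact Or.inl (pos_of_mul_pos_right (by nlinarith : 0 < A * a) hA0.le)
    · exact absurd ⟨hb'.symm, hc'.symm⟩ hb0

theorem exists_relation {x y z w : ModelPlane κ} (hx : 0 < tangentForm κ z.1 x.1 x.1)
    (hy : 0 < tangentForm κ z.1 y.1 y.1) (hw : 0 < tangentForm κ z.1 w.1 w.1)
    (hangle : Real.pi ≤ angle y z x + angle x z w)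
    (hside : det x.1 z.1 y.1 * det x.1 z.1 w.1 ≤ 0) :
    ∃ a b c k : ℝ, 0 ≤ a ∧ 0 ≤ b ∧ 0 ≤ c ∧ (0 < a ∨ 0 < b ∧ 0 < c) ∧
      a • x.1 + b • y.1 + c • w.1 = k • z.1 := by
  simp only [angle, metric_initialVector] at hangle
  have hVsq := tangentForm_mul_self z x y
  have hQsq := tangentForm_mul_self z x w
  have hcomm : tangentForm κ z.1 x.1 y.1 = tangentForm κ z.1 y.1 x.1 := by
    simp only [tangentForm]; ring
  rw [hcomm] at hVsq
  set A := tangentForm κ z.1 x.1 x.1 with hA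
  set P := tangentForm κ z.1 y.1 x.1 with hP
  set R := tangentForm κ z.1 x.1 w.1 with hR
  set V := √A * √(tangentForm κ z.1 y.1 y.1) with hV
  set Q := √A * √(tangentForm κ z.1 w.1 w.1) with hQ
  have hV0 : 0 < V := mul_pos (Real.sqrt_pos.2 hx) (Real.sqrt_pos.2 hy)
  have hQ0 : 0 < Q := mul_pos (Real.sqrt_pos.2 hx) (Real.sqrt_pos.2 hw)
  have hV2 : V ^ 2 = P ^ 2 + det x.1 z.1 y.1 ^ 2 := by
    rw [hV, mul_pow, Real.sq_sqrt hx.le, Real.sq_sqrt hy.le, hVsq]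
  have hQ2 : Q ^ 2 = R ^ 2 + det x.1 z.1 w.1 ^ 2 := by
    rw [hQ, mul_pow, Real.sq_sqrt hx.le, Real.sq_sqrt hw.le, hQsq]
  rw [mul_comm (√(tangentForm κ z.1 y.1 y.1)), ← hV] at hangle
  -- The angle condition says that the cosines satisfy `P / V + R / Q ≤ 0`, as `arccos` is
  -- decreasing and `arccos (-t) = π - arccos t`.
  have h : P * Q + R * V ≤ 0 := by
    have hPV : |P| ≤ V := abs_le_of_sq_le_sq (by nlinarith [sq_nonneg (det x.1 z.1 y.1)]) hV0.le
    have hRQ : |R| ≤ Q := abs_le_of_sq_le_sq (by nlinarith [sq_nonneg (det x.1 z.1 w.1)]) hQ0.le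
    have h1 : P / V ≤ 1 := (div_le_one hV0).2 (abs_le.1 hPV).2
    have h2 : -1 ≤ -(R / Q) := neg_le_neg ((div_le_one hQ0).2 (abs_le.1 hRQ).2)
    by_contra h0
    have h3 : -(R / Q) < P / V := by
      rw [← neg_div, div_lt_div_iff₀ hQ0 hV0]
      linarith
    have h4 := Real.arccos_lt_arccos h2 h3 h1
    rw [Real.arccos_neg] at h4
    linarith
  rcases mul_nonpos_iff.1 hside with ⟨h1, h2⟩ | ⟨h1, h2⟩
  · exact exists_relation_of_nonneg (b := -det x.1 z.1 w.1) (c := det x.1 z.1 y.1) hP hR hA hx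
      hV2 (by rw [hQ2]; ring) hV0 hQ0 h (by linarith) h1 (Or.inl ⟨rfl, rfl⟩)
  · exact exists_relation_of_nonneg (b := det x.1 z.1 w.1) (c := -det x.1 z.1 y.1) hP hR hA hx
      (by rw [hV2]; ring) hQ2 hV0 hQ0 h h2 (by linarith) (Or.inr ⟨rfl, rfl⟩)

/-! ### Closed polygons of length less than `2π` -/

section Chain

open InnerProductGeometry

variable {V : Type*} [NormedAddCommGroup V] [InnerProductSpace ℝ V]

theorem angle_cone_eq_add {x y N : V} {a b : ℝ} (ha : 0 ≤ a) (hb : 0 ≤ b) (hN : N ≠ 0)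
    (h : N = a • x + b • y) : InnerProductGeometry.angle x y
      = InnerProductGeometry.angle x N + InnerProductGeometry.angle N y := by
  refine angle_eq_angle_add_add_angle_add_of_mem_span hN ?_
  rw [Submodule.mem_span_pair]
  exact ⟨⟨a, ha⟩, ⟨b, hb⟩, by rw [h]; rfl⟩

theorem ne_zero_of_angle_lt_pi {x y : V} {a b : ℝ} (hx : x ≠ 0) (hy : y ≠ 0) (ha : 0 ≤ a)
    (hb : 0 ≤ b) (h : InnerProductGeometry.angle x y < Real.pi) (h0 : a • x + b • y = 0) :
    a = 0 ∧ b = 0 := by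
  by_contra hab
  have hb' : b ≠ 0 := by
    rintro rfl
    simp_all
  have ha' : a ≠ 0 := by
    rintro rfl
    simp_all
  refine h.ne (InnerProductGeometry.angle_eq_pi_iff.2 ⟨hx, -(a / b), ?_, ?_⟩)
  · have := div_pos (ha.lt_of_ne' ha') (hb.lt_of_ne' hb')
    linarith
  · have : b • y = -(a • x) := by rw [eq_neg_iff_add_eq_zero, add_comm, h0]
    rw [neg_smul, div_eq_inv_mul, mul_smul, ← smul_neg, ← this, smul_smul, inv_mul_cancel₀ hb',
      one_smul]

/-- A closed spherical quadrilateral of length less than `2π` lies in an open hemisphere, stated in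
the dual form: `0` is not a nontrivial nonnegative combination of its vertices. -/
theorem eq_zero_of_angle_sum_lt {x y z w : V} (hx : x ≠ 0) (hy : y ≠ 0) (hz : z ≠ 0) (hw : w ≠ 0)
    (hyz : InnerProductGeometry.angle y z < Real.pi)
    (hwx : InnerProductGeometry.angle w x < Real.pi)
    (hsum : InnerProductGeometry.angle x y + InnerProductGeometry.angle y z
      + InnerProductGeometry.angle z w + InnerProductGeometry.angle w x < 2 * Real.pi)
    {a b c k : ℝ} (ha : 0 ≤ a) (hb : 0 ≤ b) (hc : 0 ≤ c) (hk : 0 ≤ k)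
    (h : a • x + b • y + c • w + k • z = 0) : a = 0 ∧ b = 0 ∧ c = 0 := by
  have hN' : -(b • y + k • z) = c • w + a • x := by
    rw [neg_eq_iff_add_eq_zero, ← h]; abel
  by_cases hN : b • y + k • z = 0
  · obtain ⟨rfl, rfl⟩ := ne_zero_of_angle_lt_pi hy hz hb hk hyz hN
    obtain ⟨rfl, rfl⟩ := ne_zero_of_angle_lt_pi hw hx hc ha hwx (by rw [← hN', hN, neg_zero])
    simp
  -- `N` lies in the cone of `y` and `z`, and `-N` in that of `w` and `x`. The closed polygon passes
  -- through antipodal directions, so its length is at least `2π`.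
  · exfalso
    have h1 := angle_cone_eq_add hb hk hN rfl
    have h2 := angle_cone_eq_add hc ha (neg_ne_zero.2 hN) hN'
    set N := b • y + k • z
    have h3 := angle_le_angle_add_angle (-N) x y
    have h4 := angle_le_angle_add_angle (-N) y N
    have h5 := angle_le_angle_add_angle N z w
    have h6 := angle_le_angle_add_angle N w (-N)
    rw [angle_neg_self_of_nonzero hN] at h4
    rw [angle_self_neg_of_nonzero hN] at h6
    linarith

end Chain

/-- The linear map carrying `ModelPlane κ` onto the unit sphere, for `κ > 0`. -/
def toSphere (κ : ℝ) : Ambient →ₗ[ℝ] EuclideanSpace ℝ (Fin 3) where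
  toFun p := !₂[p.1, √κ * p.2 0, √κ * p.2 1]
  map_add' p q := by ext i; fin_cases i <;> simp [mul_add]
  map_smul' a p := by ext i; fin_cases i <;> simp [mul_left_comm]

theorem inner_toSphere (hκ : 0 < κ) (p q : Ambient) :
    inner ℝ (toSphere κ p) (toSphere κ q) = form κ p q := by
  have h := Real.mul_self_sqrt hκ.le
  simp only [toSphere, form_eq, PiLp.inner_apply, Fin.sum_univ_three, LinearMap.coe_mk,
    AddHom.coe_mk]
  simp
  linear_combination (p.2 0 * q.2 0 + p.2 1 * q.2 1) * h

theorem norm_toSphere (hκ : 0 < κ) (p : ModelPlane κ) : ‖toSphere κ p.1‖ = 1 := by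
  have h := inner_toSphere hκ p.1 p.1
  rw [form_self, real_inner_self_eq_norm_sq] at h
  exact (pow_eq_one_iff_of_nonneg (norm_nonneg _) two_ne_zero).1 h

theorem angle_toSphere (hκ : 0 < κ) (p q : ModelPlane κ) :
    InnerProductGeometry.angle (toSphere κ p.1) (toSphere κ q.1) = √κ * dist p q := by
  rw [InnerProductGeometry.angle, inner_toSphere hκ, norm_toSphere hκ, norm_toSphere hκ,
    dist_of_pos hκ, mul_div_cancel₀ _ (Real.sqrt_pos.2 hκ).ne']
  simp

theorem form_ne_neg_one (hκ : 0 < κ) {p q : ModelPlane κ} (h : √κ * dist p q < Real.pi) :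
    form κ p.1 q.1 ≠ -1 := by
  intro h1
  rw [dist_of_pos hκ, mul_div_cancel₀ _ (Real.sqrt_pos.2 hκ).ne', h1, Real.arccos_neg_one] at h
  exact h.false

theorem dist_triangle_of_pos (hκ : 0 < κ) (p q r : ModelPlane κ) :
    √κ * dist p r ≤ √κ * dist p q + √κ * dist q r := by
  simp only [← angle_toSphere hκ]
  exact InnerProductGeometry.angle_le_angle_add_angle _ _ _

/-! ### The comparison of the second diagonals -/

variable {x y z w x' y' z' w' : ModelPlane κ} {a b c k : ℝ}

theorem form_relation (h : a • x.1 + b • y.1 + c • w.1 = k • z.1) (q : Ambient) :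
    a * form κ x.1 q + b * form κ y.1 q + c * form κ w.1 q = k * form κ z.1 q := by
  simpa only [form_add_left, form_smul_left] using congrArg (fun v => form κ v q) h

/-- The defect of the transported linear relation, and its products with the four points. -/
theorem form_defect (h : a • x.1 + b • y.1 + c • w.1 = k • z.1)
    (hxy : form κ x'.1 y'.1 = form κ x.1 y.1) (hyz : form κ y'.1 z'.1 = form κ y.1 z.1)
    (hzw : form κ z'.1 w'.1 = form κ z.1 w.1) (hwx : form κ w'.1 x'.1 = form κ w.1 x.1) :
    ∃ e : Ambient,
      form κ e x'.1 = -(k * (form κ x.1 z.1 - form κ x'.1 z'.1)) ∧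
      form κ e z'.1 = a * (form κ x.1 z.1 - form κ x'.1 z'.1) ∧
      form κ e e = 2 * (k * a * (form κ x.1 z.1 - form κ x'.1 z'.1))
        + 2 * (b * c * (form κ y'.1 w'.1 - form κ y.1 w.1)) := by
  have hl : ∀ q, form κ (k • z'.1 - a • x'.1 - b • y'.1 - c • w'.1) q
      = k * form κ z'.1 q - a * form κ x'.1 q - b * form κ y'.1 q - c * form κ w'.1 q := by
    intro q; simp only [form_sub_left, form_smul_left]
  have hx := form_relation h x.1
  have hy := form_relation h y.1
  have hz := form_relation h z.1
  have hw := form_relation h w.1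
  have hx' : form κ (k • z'.1 - a • x'.1 - b • y'.1 - c • w'.1) x'.1
      = -(k * (form κ x.1 z.1 - form κ x'.1 z'.1)) := by
    rw [hl, form_comm κ z'.1, form_comm κ y'.1, hxy, hwx, form_self]
    rw [form_comm κ z.1, form_comm κ y.1, form_self] at hx
    linear_combination -hx
  have hz' : form κ (k • z'.1 - a • x'.1 - b • y'.1 - c • w'.1) z'.1
      = a * (form κ x.1 z.1 - form κ x'.1 z'.1) := by
    rw [hl, form_comm κ w'.1, hzw, hyz, form_self]
    rw [form_comm κ w.1, form_self] at hz
    linear_combination -hz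
  have hy' : form κ (k • z'.1 - a • x'.1 - b • y'.1 - c • w'.1) y'.1
      = -(c * (form κ y'.1 w'.1 - form κ y.1 w.1)) := by
    rw [hl, form_comm κ w'.1, form_comm κ z'.1, hyz, hxy, form_self]
    rw [form_comm κ w.1, form_comm κ z.1, form_self] at hy
    linear_combination -hy
  have hw' : form κ (k • z'.1 - a • x'.1 - b • y'.1 - c • w'.1) w'.1
      = -(b * (form κ y'.1 w'.1 - form κ y.1 w.1)) := by
    rw [hl, form_comm κ x'.1, hwx, hzw, form_self]
    rw [form_comm κ x.1, form_self] at hw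
    linear_combination -hw
  refine ⟨_, hx', hz', ?_⟩
  rw [hl, form_comm κ z'.1, form_comm κ x'.1, form_comm κ y'.1, form_comm κ w'.1, hx', hy', hz',
    hw']
  ring

/-- The product of `e` with `x'` is needed because `a` may vanish, in which case `form e e` does not
see the diagonal `x z`. -/
theorem form_le_form_of_pos (hκ : 0 < κ) (h : a • x.1 + b • y.1 + c • w.1 = k • z.1)
    (ha : 0 ≤ a) (hb : 0 ≤ b) (hc : 0 ≤ c) (hk : 0 < k)
    (hxy : form κ x'.1 y'.1 = form κ x.1 y.1) (hyz : form κ y'.1 z'.1 = form κ y.1 z.1)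
    (hzw : form κ z'.1 w'.1 = form κ z.1 w.1) (hwx : form κ w'.1 x'.1 = form κ w.1 x.1)
    (hyw : form κ y'.1 w'.1 ≤ form κ y.1 w.1) : form κ x'.1 z'.1 ≤ form κ x.1 z.1 := by
  obtain ⟨e, hx, -, he⟩ := form_defect h hxy hyz hzw hwx
  by_contra hlt
  have hδ : form κ x.1 z.1 - form κ x'.1 z'.1 < 0 := by linarith
  have he0 : e = 0 := by
    by_contra he0
    have h1 := form_self_pos_of_pos hκ he0
    have h2 : k * a * (form κ x.1 z.1 - form κ x'.1 z'.1) ≤ 0 :=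
      mul_nonpos_of_nonneg_of_nonpos (by positivity) hδ.le
    have h3 : b * c * (form κ y'.1 w'.1 - form κ y.1 w.1) ≤ 0 :=
      mul_nonpos_of_nonneg_of_nonpos (by positivity) (by linarith)
    linarith
  rw [he0, form_zero_left] at hx
  nlinarith

/-- For causal `e`, Cauchy–Schwarz (`key`) bounds the spatial part of the product by the time part,
so the sign of `e.1` governs the products with all points of the upper sheet. -/
theorem form_neg_of_causal (hκ : κ < 0) {e : Ambient} (he : 0 ≤ form κ e e) {p q : ModelPlane κ}
    (hp : form κ e p.1 < 0) : form κ e q.1 < 0 := by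
  have key : ∀ r : ModelPlane κ, (κ * (e.2 0 * r.1.2 0 + e.2 1 * r.1.2 1)) ^ 2
      ≤ e.1 ^ 2 * (r.1.1 ^ 2 - 1) := by
    intro r
    have hr := coord_eq r
    have he' : 0 ≤ e.1 ^ 2 + κ * (e.2 0 ^ 2 + e.2 1 ^ 2) := by
      rw [form_eq] at he; linarith
    have hr' : 0 ≤ -κ * (r.1.2 0 ^ 2 + r.1.2 1 ^ 2) :=
      mul_nonneg (by linarith) (by positivity)
    have h1 := mul_nonneg he' hr'
    have h2 : r.1.1 ^ 2 - 1 = -κ * (r.1.2 0 ^ 2 + r.1.2 1 ^ 2) := by linarith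
    rw [h2]
    nlinarith [sq_nonneg (κ * (e.2 0 * r.1.2 1 - e.2 1 * r.1.2 0))]
  have hp0 := p.2.2 hκ.le
  have hq0 := q.2.2 hκ.le
  rw [form_eq] at hp ⊢
  have he0 : e.1 < 0 := by
    by_contra he0
    have he0 := not_lt.1 he0
    have h1 : (κ * (e.2 0 * p.1.2 0 + e.2 1 * p.1.2 1)) ^ 2 ≤ (e.1 * p.1.1) ^ 2 :=
      (key p).trans (by nlinarith [sq_nonneg e.1])
    have := abs_le_of_sq_le_sq' h1 (by positivity)
    linarith [this.1]
  have h1 : (κ * (e.2 0 * q.1.2 0 + e.2 1 * q.1.2 1)) ^ 2 < (-e.1 * q.1.1) ^ 2 :=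
    (key q).trans_lt (by nlinarith [pow_pos (neg_pos.2 he0) 2])
  have := abs_lt_of_sq_lt_sq' h1 (mul_nonneg (by linarith) hq0.le)
  linarith [this.2]

theorem form_le_form_of_neg (hκ : κ < 0) (h : a • x.1 + b • y.1 + c • w.1 = k • z.1)
    (ha : 0 ≤ a) (hb : 0 ≤ b) (hc : 0 ≤ c) (hk : 0 < k)
    (hxy : form κ x'.1 y'.1 = form κ x.1 y.1) (hyz : form κ y'.1 z'.1 = form κ y.1 z.1)
    (hzw : form κ z'.1 w'.1 = form κ z.1 w.1) (hwx : form κ w'.1 x'.1 = form κ w.1 x.1)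
    (hyw : form κ y.1 w.1 ≤ form κ y'.1 w'.1) : form κ x.1 z.1 ≤ form κ x'.1 z'.1 := by
  obtain ⟨e, hx, hz, he⟩ := form_defect h hxy hyz hzw hwx
  by_contra hlt
  have hδ : 0 < form κ x.1 z.1 - form κ x'.1 z'.1 := by linarith
  have h2 : 0 ≤ k * a * (form κ x.1 z.1 - form κ x'.1 z'.1) := by positivity
  have h3 : 0 ≤ b * c * (form κ y'.1 w'.1 - form κ y.1 w.1) :=
    mul_nonneg (by positivity) (by linarith)
  have h4 := form_neg_of_causal hκ (by linarith : 0 ≤ form κ e e) (p := x') (q := z')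
    (by rw [hx]; nlinarith)
  have : 0 ≤ form κ e z'.1 := by rw [hz]; positivity
  linarith

/-- Euclidean substitute for `form e e`: since the coefficients of `e` sum to zero, its squared norm
depends only on mutual distances. -/
theorem sum_sq_eq_of_zero (x y z w : ModelPlane 0) {a b c k : ℝ} (hk : k = a + b + c) :
    (k * z.1.2 0 - a * x.1.2 0 - b * y.1.2 0 - c * w.1.2 0) ^ 2
        + (k * z.1.2 1 - a * x.1.2 1 - b * y.1.2 1 - c * w.1.2 1) ^ 2
      = k * (a * dist x z ^ 2 + b * dist y z ^ 2 + c * dist z w ^ 2)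
        - a * b * dist x y ^ 2 - a * c * dist w x ^ 2 - b * c * dist y w ^ 2 := by
  simp only [dist_sq_of_zero, hk]
  ring

/-- Pairing the vanishing defect with `2 (z - x)` shows that the sides determine the diagonal. -/
theorem mul_dist_sq_of_zero (x y z w : ModelPlane 0) {a b c k : ℝ} (hk : k = a + b + c)
    (e0 : k * z.1.2 0 - a * x.1.2 0 - b * y.1.2 0 - c * w.1.2 0 = 0)
    (e1 : k * z.1.2 1 - a * x.1.2 1 - b * y.1.2 1 - c * w.1.2 1 = 0) :
    (k + a) * dist x z ^ 2
      = b * dist x y ^ 2 + c * dist w x ^ 2 - b * dist y z ^ 2 - c * dist z w ^ 2 := by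
  simp only [dist_sq_of_zero]
  rw [hk] at e0 e1 ⊢
  linear_combination 2 * (z.1.2 0 - x.1.2 0) * e0 + 2 * (z.1.2 1 - x.1.2 1) * e1

theorem dist_le_dist_of_zero {x y z w x' y' z' w' : ModelPlane 0} {a b c k : ℝ}
    (h : a • x.1 + b • y.1 + c • w.1 = k • z.1)
    (ha : 0 ≤ a) (hb : 0 ≤ b) (hc : 0 ≤ c) (hk : 0 < k)
    (hxy : dist x y = dist x' y') (hyz : dist y z = dist y' z') (hzw : dist z w = dist z' w')
    (hwx : dist w x = dist w' x') (hyw : dist y w ≤ dist y' w') : dist x z ≤ dist x' z' := by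
  have hk' : k = a + b + c := by
    have := congrArg (fun v : Ambient => v.1) h
    simp [fst_eq_one] at this
    exact this.symm
  have h0 : a * x.1.2 0 + b * y.1.2 0 + c * w.1.2 0 = k * z.1.2 0 := by
    simpa using congrArg (fun v : Ambient => v.2 0) h
  have h1 : a * x.1.2 1 + b * y.1.2 1 + c * w.1.2 1 = k * z.1.2 1 := by
    simpa using congrArg (fun v : Ambient => v.2 1) h
  have e0 : k * z.1.2 0 - a * x.1.2 0 - b * y.1.2 0 - c * w.1.2 0 = 0 := by linarith
  have e1 : k * z.1.2 1 - a * x.1.2 1 - b * y.1.2 1 - c * w.1.2 1 = 0 := by linarith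
  by_contra hlt
  have hδ : 0 < dist x z ^ 2 - dist x' z' ^ 2 :=
    sub_pos.2 (pow_lt_pow_left₀ (not_le.1 hlt) (dist_nonneg _ _) two_ne_zero)
  have hε : 0 ≤ dist y' w' ^ 2 - dist y w ^ 2 :=
    sub_nonneg.2 (pow_le_pow_left₀ (dist_nonneg _ _) hyw 2)
  have s := sum_sq_eq_of_zero x y z w hk'
  have s' := sum_sq_eq_of_zero x' y' z' w' hk'
  rw [e0, e1, hxy, hyz, hzw, hwx] at s
  have hkaδ : 0 ≤ k * a * (dist x z ^ 2 - dist x' z' ^ 2) := by positivity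
  have hbcε : 0 ≤ b * c * (dist y' w' ^ 2 - dist y w ^ 2) := by positivity
  have hsum : (k * z'.1.2 0 - a * x'.1.2 0 - b * y'.1.2 0 - c * w'.1.2 0) ^ 2
        + (k * z'.1.2 1 - a * x'.1.2 1 - b * y'.1.2 1 - c * w'.1.2 1) ^ 2 = 0 :=
    le_antisymm (by linarith) (by positivity)
  rw [add_eq_zero_iff_of_nonneg (sq_nonneg _) (sq_nonneg _), sq_eq_zero_iff,
    sq_eq_zero_iff] at hsum
  have l := mul_dist_sq_of_zero x y z w hk' e0 e1
  rw [hxy, hyz, hzw, hwx, ← mul_dist_sq_of_zero x' y' z' w' hk' hsum.1 hsum.2] at l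
  have := mul_left_cancel₀ (by linarith : k + a ≠ 0) l
  linarith

/-! ### Side lengths, perimeter and the sign of `k` -/

theorem form_eq_of_dist_eq (hκ : κ ≠ 0) {p q p' q' : ModelPlane κ} (h : dist p q = dist p' q') :
    form κ p'.1 q'.1 = form κ p.1 q.1 := by
  rcases lt_or_gt_of_ne hκ with hκ | hκ
  · exact ((dist_le_dist_of_neg hκ _ _ _ _).1 h.ge).antisymm
      ((dist_le_dist_of_neg hκ _ _ _ _).1 h.le)
  · exact ((dist_le_dist_of_pos hκ _ _ _ _).1 h.le).antisymm
      ((dist_le_dist_of_pos hκ _ _ _ _).1 h.ge)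

/-- Below the threshold `2 D_κ`, the angular perimeter is less than `2π`. -/
theorem sqrt_mul_lt_of_lt_diam (hκ : 0 < κ) {l : ℝ} (h : (l : EReal) < 2 * diam κ) :
    √κ * l < 2 * Real.pi := by
  rw [diam, if_pos hκ] at h
  have h' : l < 2 * (Real.pi / √κ) := by
    rwa [show (2 : EReal) = ((2 : ℝ) : EReal) from rfl, ← EReal.coe_mul,
      EReal.coe_lt_coe_iff] at h
  rw [← mul_div_assoc, lt_div_iff₀ (Real.sqrt_pos.2 hκ)] at h'
  linarith

/-- The coefficient of the reflex vertex is positive. -/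
theorem coeff_pos {x y z w : ModelPlane κ}
    (hperim : 0 < κ → √κ * dist x y + √κ * dist y z + √κ * dist z w + √κ * dist w x
      < 2 * Real.pi)
    (hyz : 0 < κ → √κ * dist y z < Real.pi) (hwx : 0 < κ → √κ * dist w x < Real.pi)
    {a b c k : ℝ} (ha : 0 ≤ a) (hb : 0 ≤ b) (hc : 0 ≤ c) (habc : 0 < a ∨ 0 < b ∧ 0 < c)
    (h : a • x.1 + b • y.1 + c • w.1 = k • z.1) : 0 < k := by
  rcases lt_or_ge 0 κ with hκ | hκ
  · by_contra hk
    have hne : ∀ p : ModelPlane κ, toSphere κ p.1 ≠ 0 := fun p h0 => by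
      have := norm_toSphere hκ p
      simp [h0] at this
    have h' : a • toSphere κ x.1 + b • toSphere κ y.1 + c • toSphere κ w.1
        + (-k) • toSphere κ z.1 = 0 := by
      simp only [← map_smul, ← map_add]
      rw [h, ← add_smul, add_neg_cancel, zero_smul, map_zero]
    have := eq_zero_of_angle_sum_lt (hne x) (hne y) (hne z) (hne w)
      (by rw [angle_toSphere hκ]; exact hyz hκ) (by rw [angle_toSphere hκ]; exact hwx hκ)
      (by simpa only [angle_toSphere hκ] using hperim hκ) ha hb hc (by linarith) h'
    rcases habc with h1 | ⟨h1, -⟩ <;> linarith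
  -- For `κ ≤ 0` all products of points are positive, so pairing the relation with `z` exhibits `k`
  -- as a positive sum.
  · have hrel := form_relation h z.1
    rw [form_self, mul_one] at hrel
    rw [← hrel]
    have hx := form_pos_of_nonpos hκ x z
    have hy := form_pos_of_nonpos hκ y z
    have hw := form_pos_of_nonpos hκ w z
    rcases habc with h1 | ⟨h1, h2⟩ <;> positivity

end ModelPlane
end

/-! ### Proof of the lemma -/

theorem mainTheorem9 (κ : ℝ) (x y z w x' y' z' w' : ModelPlane κ)
    (hperim : ((ModelPlane.dist x y + ModelPlane.dist y z + ModelPlane.dist z w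
      + ModelPlane.dist w x : ℝ) : EReal) < 2 * ModelPlane.diam κ)
    (hxy : ModelPlane.dist x y = ModelPlane.dist x' y')
    (hyz : ModelPlane.dist y z = ModelPlane.dist y' z')
    (hzw : ModelPlane.dist z w = ModelPlane.dist z' w')
    (hwx : ModelPlane.dist w x = ModelPlane.dist w' x')
    (hyw : ModelPlane.dist y w ≤ ModelPlane.dist y' w')
    (hreflex : x ≠ y → x ≠ z → x ≠ w → y ≠ z → z ≠ w →
      Real.pi ≤ ModelPlane.angle y z x + ModelPlane.angle x z w ∧
      ∃ L : Set (ModelPlane κ), ModelPlane.IsLine L ∧ x ∈ L ∧ z ∈ L ∧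
        ¬ ModelPlane.SameSide L y w) :
    ModelPlane.dist x z ≤ ModelPlane.dist x' z' := by
  -- When a side degenerates, so does its counterpart, and the diagonal is itself a side; when `x =
  -- z` the left side is `0`.
  by_cases hxy0 : x = y
  · subst hxy0
    rw [ModelPlane.dist_self] at hxy
    rw [hyz, ModelPlane.eq_of_dist_eq_zero hxy.symm]
  by_cases hxz0 : x = z
  · rw [hxz0, ModelPlane.dist_self]
    exact ModelPlane.dist_nonneg _ _
  by_cases hxw0 : x = w
  · subst hxw0
    rw [ModelPlane.dist_self] at hwx
    rw [ModelPlane.dist_comm, hzw, ModelPlane.eq_of_dist_eq_zero hwx.symm, ModelPlane.dist_comm]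
  by_cases hyz0 : y = z
  · subst hyz0
    rw [ModelPlane.dist_self] at hyz
    rw [hxy, ModelPlane.eq_of_dist_eq_zero hyz.symm]
  by_cases hzw0 : z = w
  · subst hzw0
    rw [ModelPlane.dist_self] at hzw
    rw [ModelPlane.dist_comm, hwx, ModelPlane.eq_of_dist_eq_zero hzw.symm, ModelPlane.dist_comm]
  obtain ⟨hangle, L, hL, hxL, hzL, hside⟩ := hreflex hxy0 hxz0 hxw0 hyz0 hzw0
  have hside := hL.det_mul_det_nonpos hxL hzL hside
  have hperim' : 0 < κ → √κ * ModelPlane.dist x y + √κ * ModelPlane.dist y z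
      + √κ * ModelPlane.dist z w + √κ * ModelPlane.dist w x < 2 * Real.pi := by
    intro hκ
    have := ModelPlane.sqrt_mul_lt_of_lt_diam hκ hperim
    linarith
  -- By the triangle inequality each of these distances is at most half the perimeter, so none of
  -- the pairs is antipodal.
  have hlt : 0 < κ → √κ * ModelPlane.dist x z < Real.pi ∧ √κ * ModelPlane.dist y z < Real.pi ∧
      √κ * ModelPlane.dist w z < Real.pi ∧ √κ * ModelPlane.dist w x < Real.pi := by
    intro hκ
    have h0 := hperim' hκ
    have h1 := ModelPlane.dist_triangle_of_pos hκ x y z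
    have h2 := ModelPlane.dist_triangle_of_pos hκ x w z
    have h3 := ModelPlane.dist_triangle_of_pos hκ y x z
    have h4 := ModelPlane.dist_triangle_of_pos hκ w x z
    have h5 := ModelPlane.dist_triangle_of_pos hκ w z x
    rw [ModelPlane.dist_comm x w, ModelPlane.dist_comm w z] at h2
    rw [ModelPlane.dist_comm y x] at h3
    rw [ModelPlane.dist_comm w z] at h4 h5
    rw [ModelPlane.dist_comm z x] at h5
    rw [ModelPlane.dist_comm w z]
    refine ⟨?_, ?_, ?_, ?_⟩ <;> linarith
  obtain ⟨a, b, c, k, ha, hb, hc, habc, hrel⟩ := ModelPlane.exists_relation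
    (ModelPlane.tangentForm_self_pos hxz0 fun hκ => ModelPlane.form_ne_neg_one hκ (hlt hκ).1)
    (ModelPlane.tangentForm_self_pos hyz0 fun hκ => ModelPlane.form_ne_neg_one hκ (hlt hκ).2.1)
    (ModelPlane.tangentForm_self_pos (Ne.symm hzw0) fun hκ => ModelPlane.form_ne_neg_one hκ (hlt hκ).2.2.1)
    hangle hside
  have hk := ModelPlane.coeff_pos hperim' (fun hκ => (hlt hκ).2.1) (fun hκ => (hlt hκ).2.2.2) ha hb hc habc
    hrel
  rcases lt_trichotomy κ 0 with hκ | rfl | hκ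
  · rw [ModelPlane.dist_le_dist_of_neg hκ] at hyw ⊢
    exact ModelPlane.form_le_form_of_neg hκ hrel ha hb hc hk (ModelPlane.form_eq_of_dist_eq hκ.ne hxy)
      (ModelPlane.form_eq_of_dist_eq hκ.ne hyz) (ModelPlane.form_eq_of_dist_eq hκ.ne hzw)
      (ModelPlane.form_eq_of_dist_eq hκ.ne hwx) hyw
  · exact ModelPlane.dist_le_dist_of_zero hrel ha hb hc hk hxy hyz hzw hwx hyw
  · rw [ModelPlane.dist_le_dist_of_pos hκ] at hyw ⊢
    exact ModelPlane.form_le_form_of_pos hκ hrel ha hb hc hk (ModelPlane.form_eq_of_dist_eq hκ.ne' hxy)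
      (ModelPlane.form_eq_of_dist_eq hκ.ne' hyz) (ModelPlane.form_eq_of_dist_eq hκ.ne' hzw)
      (ModelPlane.form_eq_of_dist_eq hκ.ne' hwx) hyw
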